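/- Let $P\ge 1$, let $I_1,\dots,I_P$ be powers of two, and put $\tilde I=I_1I_2\cdots I_P$. For each $p$, let $\mathbf H^{(p)}\in\mathbb R^{I_p\times I_p}$ be the normalized Walsh--Hadamard matrix, with entries $I_p^{-1/2}(-1)^{\langle i,j\rangle}$, $0\le i,j<I_p$, where $\langle i,j\rangle$ is the number of positions at which the binary expansions of $i$ and $j$ both have the digit $1$. Let $\mathbf D^{(p)}\in\mathbb R^{I_p\times I_p}$ be a diagonal matrix with i.i.d. Rademacher variables ($\pm1$ with probability $1/2$ each) on the diagonal, and let $\mathbf\Phi=\mathbf H^{(1)}\mathbf D^{(1)}\otimes\cdots\otimes\mathbf H^{(P)}\mathbf D^{(P)}$. Let $\mathbf q$ be the uniform distribution on $\{1,\dots,\tilde I\}$, let $v_1,\dots,v_J$ be i.i.d. with law $\mathbf q$, and let $\mathbf S_{\mathbf q}\in\mathbb R^{J\times\tilde I}$ be the matrix whose $j$th row is $(Jq_{v_j})^{-1/2}\mathbf e_{v_j}^\top$. All the signs and all the $v_j$ are independent. The random map $\mathbf x\mapsto\mathbf S_{\mathbf q}\mathbf\Phi\mathbf x$ is the Kronecker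 fast Johnson--Lindenstrauss transform (KFJLT). Let $\mathcal Y\subseteq\mathbb R^{\tilde I}$ be the set of all Kronecker vectors $\mathbf x^{(1)}\otimes\cdots\otimes\mathbf x^{(P)}$ with $\mathbf x^{(p)}\in\mathbb R^{I_p}$. **Theorem.** Let $\varepsilon\in(0,1)$ and $\delta>0$, and let $N$ be a positive integer. If $$J>\frac{16}{3}\cdot 4^P\,\varepsilon^{-2}\,\ln\Big(\frac{4N^2(P+1)}{\delta}\Big)\prod_{p=1}^P\ln\Big(\frac{4I_pN^2(P+1)}{\delta}\Big),$$ then the KFJLT is a $\mathrm{JLT}(\varepsilon,\delta,N)$ on $\mathcal Y$: for every set $\mathcal X\subseteq\mathcal Y$ of $N$ distinct vectors, with probability at least $1-\delta$, for all $\mathbf x,\mathbf y\in\mathcal X$, $$(1-\varepsilon)\|\mathbf x-\mathbf y\|_2^2\le\|\mathbf S_{\mathbf q}\mathbf\Phi\mathbf x-\mathbf S_{\mathbf q}\mathbf\Phi\mathbf y\|_2^2\le(1+\varepsilon)\|\mathbf x-\mathbf y\|_2^2 .$$ -/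

import Mathlib

open MeasureTheory

/-- The normalized (Walsh--)Hadamard matrix of size `n`, for `n` a power of two: with rows and
columns numbered from `0`, its `(i, j)` entry is `n ^ (-1/2) * (-1) ^ ⟨i, j⟩`, where `⟨i, j⟩` is the
number of binary digits that are equal to `1` in both `i` and `j` (all digits of a number below
`n` have position below `n`). -/
noncomputable def hadamardMatrix (n : ℕ) : Matrix (Fin n) (Fin n) ℝ :=
  Matrix.of fun i j =>
    (-1 : ℝ) ^ ((Finset.range n).filter
      fun b => (i : ℕ).testBit b = true ∧ (j : ℕ).testBit b = true).card / √(n : ℝ)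

/-- The matrix `H D` of the randomized Hadamard transform with the signs `d` on the diagonal
of `D`. -/
noncomputable def randomizedHadamard {n : ℕ} (d : Fin n → ℤˣ) : Matrix (Fin n) (Fin n) ℝ :=
  hadamardMatrix n * Matrix.diagonal fun i => (((d i : ℤˣ) : ℤ) : ℝ)

/-- The coordinates of `ℝ ^ (I₁ ⋯ I_P)`, written as multi-indices `(i₁, …, i_P)`. -/
abbrev KronIndex {P : ℕ} (I : Fin P → ℕ) : Type := (p : Fin P) → Fin (I p)

/-- The Kronecker product of the vectors `x 0, …, x (P - 1)`. -/
noncomputable def kronVec {P : ℕ} {I : Fin P → ℕ}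
    (x : (p : Fin P) → EuclideanSpace ℝ (Fin (I p))) : EuclideanSpace ℝ (KronIndex I) :=
  WithLp.toLp 2 fun i => ∏ p, x p (i p)

/-- The Kronecker product of the square matrices `A 0, …, A (P - 1)`. -/
noncomputable def kronMatrix {P : ℕ} {I : Fin P → ℕ}
    (A : (p : Fin P) → Matrix (Fin (I p)) (Fin (I p)) ℝ) :
    Matrix (KronIndex I) (KronIndex I) ℝ :=
  Matrix.of fun i j => ∏ p, A p (i p) (j p)

/-- The set of Kronecker vectors. -/
def kroneckerVectors {P : ℕ} (I : Fin P → ℕ) : Set (EuclideanSpace ℝ (KronIndex I)) :=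
  {x | ∃ y : (p : Fin P) → EuclideanSpace ℝ (Fin (I p)), x = kronVec y}

/-- The rescaled sampling matrix `S_q = R Ω` of the sample `v`: row `j` of `Ω` is the unit row
vector at `v j`, and `R` is diagonal with entries `1 / √(J q_{v j})`. -/
noncomputable def samplingMatrix {J : ℕ} {ι : Type*} [DecidableEq ι] (q : PMF ι)
    (v : Fin J → ι) : Matrix (Fin J) ι ℝ :=
  Matrix.diagonal (fun j => 1 / √((J : ℝ) * (q (v j)).toReal)) *
    Matrix.of fun j i => if i = v j then (1 : ℝ) else 0

/-- The random bits of the KFJLT: the diagonal signs of each `D p`, and the `J` sampled rows. -/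
abbrev KFJLTSeed {P : ℕ} (I : Fin P → ℕ) (J : ℕ) : Type :=
  ((p : Fin P) → Fin (I p) → ℤˣ) × (Fin J → KronIndex I)

/-- Every set of signs is measurable. -/
instance : DiscreteMeasurableSpace ℤˣ :=
  ⟨fun s => ⟨Units.val '' s, MeasurableSet.of_discrete, Set.preimage_image_eq s Units.val_injective⟩⟩

/-- The space of random bits is finite and every subset of it is measurable. -/
theorem KFJLTSeed.measurableSet {P : ℕ} {I : Fin P → ℕ} {J : ℕ} (s : Set (KFJLTSeed I J)) :
    MeasurableSet s :=
  s.toFinite.measurableSet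

/-- The uniform distribution on the coordinates of `ℝ ^ (I₁ ⋯ I_P)`. -/
noncomputable def uniformIndex {P : ℕ} (I : Fin P → ℕ) [∀ p, NeZero (I p)] : PMF (KronIndex I) :=
  PMF.uniformOfFintype (KronIndex I)

/-- The law of the random bits: all signs are Rademacher, all sampled rows are uniformly
distributed, and all of them are independent. -/
noncomputable def kfjltLaw {P : ℕ} (I : Fin P → ℕ) [∀ p, NeZero (I p)] (J : ℕ) :
    Measure (KFJLTSeed I J) :=
  (Measure.pi fun p : Fin P => Measure.pi fun _ : Fin (I p) =>
      (PMF.uniformOfFintype ℤˣ).toMeasure).prod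
    (Measure.pi fun _ : Fin J => (uniformIndex I).toMeasure)

/-- The matrix `S_q Φ` of the KFJLT, where `Φ` is the Kronecker product of the randomized
Hadamard transforms and `q` is uniform. -/
noncomputable def kfjltMatrix {P : ℕ} (I : Fin P → ℕ) [∀ p, NeZero (I p)] (J : ℕ)
    (ω : KFJLTSeed I J) : Matrix (Fin J) (KronIndex I) ℝ :=
  samplingMatrix (uniformIndex I) ω.2 * kronMatrix fun p => randomizedHadamard (ω.1 p)

/-- The KFJLT as a random map between Euclidean spaces. -/
noncomputable def kfjlt {P : ℕ} (I : Fin P → ℕ) [∀ p, NeZero (I p)] (J : ℕ)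
    (ω : KFJLTSeed I J) (x : EuclideanSpace ℝ (KronIndex I)) : EuclideanSpace ℝ (Fin J) :=
  WithLp.toLp 2 (Matrix.mulVec (kfjltMatrix I J ω) x.ofLp)

/-- The random map `f`, defined on the probability space `(Ω, μ)`, is a Johnson--Lindenstrauss
transform `JLT(ε, δ, N)` on the set `Y`. -/
def IsJLT {Ω E F : Type*} [MeasurableSpace Ω] [SeminormedAddCommGroup E]
    [SeminormedAddCommGroup F] (μ : Measure Ω) (f : Ω → E → F) (Y : Set E)
    (ε δ : ℝ) (N : ℕ) : Prop :=
  ∀ X : Finset E, (X : Set E) ⊆ Y → X.card = N →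
    1 - δ ≤ μ.real {ω | ∀ x ∈ X, ∀ y ∈ X,
      (1 - ε) * ‖x - y‖ ^ 2 ≤ ‖f ω x - f ω y‖ ^ 2 ∧
        ‖f ω x - f ω y‖ ^ 2 ≤ (1 + ε) * ‖x - y‖ ^ 2}

/-!
# The Kronecker fast Johnson--Lindenstrauss transform

The union bound over the `N ^ 2` pairs of points reduces the claim to one difference
`z = x - y` of Kronecker vectors and a failure probability of `δ / N ^ 2 = (P + 1) κ`. Such a `z`
is not a Kronecker vector, but it lies in the Kronecker product of the `P` planes spanned by the
factors of `x` and `y`. After orthogonalizing each pair of factors (`exists_orthogonal_pair`), `z`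
is a combination of `2 ^ P` pairwise orthogonal Kronecker products `⊗ u p (k p)`, to which the
Pythagorean identity applies (`sum_sq_kron_combination`).

The matrix `Φ` is orthogonal, and by Hoeffding's inequality each `H D` spreads the two vectors of
its factor: with `L p = log (4 I_p / κ)`, all entries of their images are at most `2 L p / I_p`
times the squared norm, in square, except with probability `κ`
(`measureReal_lt_sq_randomizedHadamard_mulVec_le`). The Cauchy--Schwarz inequality over the
`2 ^ P` products then shows that no squared entry of `Φ z` exceeds
`2 ^ P ∏ (2 L p / I_p) ‖z‖ ^ 2 = M / (I_1 ⋯ I_P) ‖z‖ ^ 2`, where `M = 4 ^ P ∏ L p`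
(`sq_kronMatrix_mulVec_combination_le`). Given that, `‖S Φ z‖ ^ 2 / ‖z‖ ^ 2` is `M / J` times a
sum of `J` independent variables with values in `[0, 1]` and mean `1 / M`, and the multiplicative
Chernoff bound gives the failure probability `2 exp (-J ε ^ 2 / (4 M)) ≤ κ` of the sampling
(`measureReal_sampling_failure_le`).
-/

/-! ### Exponential tail bounds -/

/-- Chernoff's method for a sum of independent terms. -/
theorem measureReal_pi_le_sum_le {ι α : Type*} [Fintype ι] [Finite α] [MeasurableSpace α]
    [MeasurableSingletonClass α] (μ : Measure α) [IsProbabilityMeasure μ]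
    (f : ι → α → ℝ) (b : ι → ℝ) (h : ∀ i, ∫ a, Real.exp (f i a) ∂μ ≤ Real.exp (b i)) (τ : ℝ) :
    (Measure.pi fun _ : ι => μ).real {ω | τ ≤ ∑ i, f i (ω i)} ≤ Real.exp (∑ i, b i - τ) := by
  have h1 := ProbabilityTheory.measure_ge_le_exp_mul_mgf
    (μ := Measure.pi fun _ : ι => μ) (X := fun ω => ∑ i, f i (ω i)) (t := 1) τ zero_le_one
    Integrable.of_finite
  refine h1.trans ?_
  rw [sub_eq_add_neg, add_comm, Real.exp_add, neg_one_mul]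
  gcongr
  simp only [ProbabilityTheory.mgf, one_mul, Real.exp_sum]
  rw [integral_fintype_prod_eq_prod (fun i a => Real.exp (f i a))]
  exact Finset.prod_le_prod (fun i _ => integral_nonneg fun a => (Real.exp_pos _).le) fun i _ => h i

/-- The moment generating function of a scaled Rademacher variable is subgaussian. -/
theorem integral_exp_mul_sign_le (a : ℝ) :
    ∫ s, Real.exp (a * (((s : ℤˣ) : ℤ) : ℝ)) ∂(PMF.uniformOfFintype ℤˣ).toMeasure
      ≤ Real.exp (a ^ 2 / 2) := by
  rw [PMF.integral_eq_sum]
  refine le_trans (le_of_eq ?_) (Real.cosh_le_exp_half_sq a)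
  have : (Finset.univ : Finset ℤˣ) = {1, -1} := rfl
  rw [this, Finset.sum_pair (by decide), Real.cosh_eq]
  simp
  ring

/-- One-sided Hoeffding inequality for Rademacher sums. -/
theorem measureReal_le_rademacher_sum_le {ι : Type*} [Fintype ι] (a : ι → ℝ) {r : ℝ}
    (ha : 0 < ∑ i, a i ^ 2) (hr : 0 ≤ r) :
    (Measure.pi fun _ : ι => (PMF.uniformOfFintype ℤˣ).toMeasure).real
      {d | r ≤ ∑ i, a i * (((d i : ℤˣ) : ℤ) : ℝ)}
      ≤ Real.exp (-(r ^ 2 / (2 * ∑ i, a i ^ 2))) := by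
  set σ := ∑ i, a i ^ 2 with hσ
  -- `r / σ` minimizes the exponent `c ^ 2 * σ / 2 - c * r` over `c`.
  set c := r / σ with hc
  have hc0 : 0 ≤ c := by positivity
  have h := measureReal_pi_le_sum_le (PMF.uniformOfFintype ℤˣ).toMeasure
    (fun i (s : ℤˣ) => c * a i * ((s : ℤ) : ℝ)) (fun i => (c * a i) ^ 2 / 2)
    (fun i => integral_exp_mul_sign_le (c * a i)) (c * r)
  refine (measureReal_mono ?_).trans (h.trans (le_of_eq ?_))
  · intro d hd
    simp only [Set.mem_ofPred_eq, mul_assoc, ← Finset.mul_sum] at hd ⊢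
    exact mul_le_mul_of_nonneg_left hd hc0
  · congr 1
    simp only [mul_pow, ← Finset.sum_div, ← Finset.mul_sum, ← hσ]
    rw [hc]
    field_simp
    ring

/-- Two-sided Hoeffding inequality for Rademacher sums, in squared form. The coefficients may all
vanish, since the inequality that defines the event is strict. -/
theorem measureReal_lt_sq_rademacher_sum_le {ι : Type*} [Fintype ι] (a : ι → ℝ) {L : ℝ}
    (hL : 0 ≤ L) :
    (Measure.pi fun _ : ι => (PMF.uniformOfFintype ℤˣ).toMeasure).real
      {d | 2 * L * ∑ i, a i ^ 2 < (∑ i, a i * (((d i : ℤˣ) : ℤ) : ℝ)) ^ 2}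
      ≤ 2 * Real.exp (-L) := by
  have hσ0 : 0 ≤ ∑ i, a i ^ 2 := Finset.sum_nonneg fun i _ => sq_nonneg _
  rcases hσ0.eq_or_lt with h0 | hpos
  · have ha : ∀ i, a i = 0 := fun i => by
      have := (Finset.sum_eq_zero_iff_of_nonneg fun i _ => sq_nonneg (a i)).1 h0.symm i
        (Finset.mem_univ i)
      exact pow_eq_zero_iff two_ne_zero |>.1 this
    simp only [ha]
    simp
    positivity
  · set σ := ∑ i, a i ^ 2 with hσ
    set r := √(2 * L * σ) with hr
    have hrsq : r ^ 2 = 2 * L * σ := Real.sq_sqrt (by positivity)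
    have h1 := measureReal_le_rademacher_sum_le a hpos (Real.sqrt_nonneg (2 * L * σ))
    have h2 := measureReal_le_rademacher_sum_le (fun i => -a i) (by simpa using hpos)
      (Real.sqrt_nonneg (2 * L * σ))
    simp only [neg_sq, neg_mul, Finset.sum_neg_distrib, ← hσ, ← hr] at h1 h2
    rw [hrsq, show 2 * L * σ / (2 * σ) = L by field_simp] at h1 h2
    rw [two_mul (Real.exp _)]
    refine (measureReal_mono ?_).trans ((measureReal_union_le _ _).trans (add_le_add h1 h2))
    intro d hd
    rw [Set.mem_ofPred_eq] at hd
    exact le_abs.1 ((Real.sqrt_le_sqrt hd.le).trans_eq (Real.sqrt_sq_eq_abs _))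

/-- A random variable with values in `[0, 1]` and mean `m` has centred moment generating function
at most `exp (s ^ 2 * m)` on `[-1, 1]`. -/
theorem integral_exp_mul_sub_le {α : Type*} [Finite α] [MeasurableSpace α]
    [MeasurableSingletonClass α] (μ : Measure α) [IsProbabilityMeasure μ] (g : α → ℝ)
    (h0 : ∀ a, 0 ≤ g a) (h1 : ∀ a, g a ≤ 1) {s : ℝ} (hs : |s| ≤ 1) :
    ∫ a, Real.exp (s * (g a - ∫ a, g a ∂μ)) ∂μ ≤ Real.exp (s ^ 2 * ∫ a, g a ∂μ) := by
  set m := ∫ a, g a ∂μ with hm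
  have hpt : ∀ a, Real.exp (s * g a) ≤ 1 + (s + s ^ 2) * g a := fun a => by
    have habs : |s * g a| ≤ 1 := by
      rw [abs_mul, abs_of_nonneg (h0 a)]
      exact mul_le_one₀ hs (h0 a) (h1 a)
    have := (abs_le.1 (Real.abs_exp_sub_one_sub_id_le habs)).2
    have hg : g a ^ 2 ≤ g a := by nlinarith [h0 a, h1 a]
    nlinarith [mul_le_mul_of_nonneg_left hg (sq_nonneg s)]
  have hint : ∫ a, Real.exp (s * g a) ∂μ ≤ 1 + (s + s ^ 2) * m := by
    refine (integral_mono Integrable.of_finite Integrable.of_finite hpt).trans (le_of_eq ?_)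
    rw [integral_add Integrable.of_finite Integrable.of_finite, integral_const_mul]
    simp [hm]
  calc ∫ a, Real.exp (s * (g a - m)) ∂μ
      = Real.exp (-(s * m)) * ∫ a, Real.exp (s * g a) ∂μ := by
        rw [← integral_const_mul]
        congr 1 with a
        rw [← Real.exp_add]
        ring_nf
    _ ≤ Real.exp (-(s * m)) * Real.exp ((s + s ^ 2) * m) := by
        gcongr
        linarith [Real.add_one_le_exp ((s + s ^ 2) * m)]
    _ = Real.exp (s ^ 2 * m) := by
        rw [← Real.exp_add]
        ring_nf

/-- Two-sided multiplicative Chernoff bound for the sum of `J` independent copies of a random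
variable with values in `[0, 1]`. -/
theorem measureReal_lt_abs_sum_sub_le {α : Type*} [Finite α] [MeasurableSpace α]
    [MeasurableSingletonClass α] (μ : Measure α) [IsProbabilityMeasure μ] (g : α → ℝ)
    (h0 : ∀ a, 0 ≤ g a) (h1 : ∀ a, g a ≤ 1) (J : ℕ) {ε : ℝ} (hε : 0 < ε) (hε1 : ε < 1) :
    (Measure.pi fun _ : Fin J => μ).real
      {v | ε * (J * ∫ a, g a ∂μ) < |∑ j, g (v j) - J * ∫ a, g a ∂μ|}
      ≤ 2 * Real.exp (-(J * (∫ a, g a ∂μ) * ε ^ 2 / 4)) := by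
  set m := ∫ a, g a ∂μ with hm
  -- The exponent `ε / 2` minimizes `s ^ 2 * (J * m) - s * (ε * (J * m))`.
  have key : ∀ s : ℝ, |s| = ε / 2 → (Measure.pi fun _ : Fin J => μ).real
      {v | ε / 2 * (ε * (J * m)) ≤ ∑ j, s * (g (v j) - m)}
      ≤ Real.exp (-(J * m * ε ^ 2 / 4)) := fun s hs => by
    refine (measureReal_pi_le_sum_le μ (fun _ a => s * (g a - m)) (fun _ : Fin J => s ^ 2 * m)
      (fun _ => integral_exp_mul_sub_le μ g h0 h1 (by linarith)) _).trans (le_of_eq ?_)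
    rw [← sq_abs, hs]
    simp only [Finset.sum_const, Finset.card_univ, Fintype.card_fin, nsmul_eq_mul]
    ring_nf
  have hpos := key (ε / 2) (abs_of_pos (by positivity))
  have hneg := key (-(ε / 2)) (by rw [abs_neg, abs_of_pos (by positivity)])
  rw [two_mul (Real.exp _)]
  refine (measureReal_mono ?_).trans ((measureReal_union_le _ _).trans (add_le_add hpos hneg))
  intro v hv
  have hsum : ∀ s : ℝ, ∑ j, s * (g (v j) - m) = s * (∑ j, g (v j) - J * m) := fun s => by
    rw [← Finset.mul_sum, Finset.sum_sub_distrib]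
    simp
  simp only [Set.mem_ofPred_eq, Set.mem_union, hsum] at hv ⊢
  refine (lt_abs.1 hv).imp (fun h => ?_) fun h => ?_ <;> nlinarith

/-! ### The Hadamard matrix -/

/-- The sign `(-1) ^ ⟨i, j⟩` of the Hadamard entry, as a product over binary digits. -/
def hadamardSign (n i j : ℕ) : ℝ :=
  ∏ b ∈ Finset.range n, if i.testBit b = true ∧ j.testBit b = true then -1 else 1

theorem hadamardMatrix_apply {n : ℕ} (i j : Fin n) :
    hadamardMatrix n i j = hadamardSign n i j / √(n : ℝ) := by
  rw [hadamardMatrix, Matrix.of_apply, hadamardSign, ← Finset.prod_filter, Finset.prod_const]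

theorem hadamardSign_comm (n i j : ℕ) : hadamardSign n i j = hadamardSign n j i := by
  simp only [hadamardSign, and_comm]

theorem hadamardSign_sq (n i j : ℕ) : hadamardSign n i j ^ 2 = 1 := by
  rw [hadamardSign, ← Finset.prod_pow]
  refine Finset.prod_eq_one fun b _ => ?_
  split_ifs <;> norm_num

/-- Flipping digit `b` of `j` changes the sign exactly when digit `b` of `i` is `1`. -/
theorem hadamardSign_xor_two_pow {n b : ℕ} (hb : b < n) (i j : ℕ) :
    hadamardSign n i (j ^^^ 2 ^ b)
      = hadamardSign n i j * if i.testBit b = true then -1 else 1 := by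
  have hprod : (∏ c ∈ Finset.range n, if c = b then (if i.testBit b = true then (-1 : ℝ) else 1)
      else 1) = if i.testBit b = true then -1 else 1 := by
    rw [Finset.prod_ite_eq', if_pos (Finset.mem_range.2 hb)]
  rw [← hprod, hadamardSign, hadamardSign, ← Finset.prod_mul_distrib]
  refine Finset.prod_congr rfl fun c _ => ?_
  rw [Nat.testBit_xor, Nat.testBit_two_pow]
  by_cases hc : c = b
  · subst hc
    cases i.testBit c <;> cases j.testBit c <;> simp
  · simp [hc, Ne.symm hc]

/-- Distinct rows of the Hadamard matrix are orthogonal: flipping a digit at which the row indices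
differ is a bijection of the columns that negates every term. -/
theorem sum_hadamardSign_mul_eq_zero {k : ℕ} {i l : Fin (2 ^ k)} (hil : i ≠ l) :
    ∑ j : Fin (2 ^ k), hadamardSign (2 ^ k) i j * hadamardSign (2 ^ k) l j = 0 := by
  obtain ⟨b, hb⟩ : ∃ b, (i : ℕ).testBit b ≠ (l : ℕ).testBit b := by
    by_contra! h
    exact hil (Fin.ext (Nat.eq_of_testBit_eq h))
  have hbk : b < k := by
    by_contra! h
    have hlt : ∀ m : Fin (2 ^ k), (m : ℕ).testBit b = false := fun m =>
      Nat.testBit_lt_two_pow (m.2.trans_le (Nat.pow_le_pow_right two_pos h))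
    exact hb (by rw [hlt, hlt])
  have hinv : Function.Involutive fun j : Fin (2 ^ k) =>
      (⟨(j : ℕ) ^^^ 2 ^ b, Nat.xor_lt_two_pow j.2 (Nat.pow_lt_pow_right one_lt_two hbk)⟩ :
        Fin (2 ^ k)) := fun j => by
    simp
  have hneg := Equiv.sum_comp (hinv.toPerm _)
    fun j : Fin (2 ^ k) => hadamardSign (2 ^ k) i j * hadamardSign (2 ^ k) l j
  simp only [Function.Involutive.coe_toPerm,
    hadamardSign_xor_two_pow (hbk.trans Nat.lt_two_pow_self)] at hneg
  have hflip : ∀ x y : ℝ, (x * if (i : ℕ).testBit b = true then -1 else 1)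
      * (y * if (l : ℕ).testBit b = true then -1 else 1) = -(x * y) := fun x y => by
    revert hb
    cases (i : ℕ).testBit b <;> cases (l : ℕ).testBit b <;> simp
  simp only [hflip, Finset.sum_neg_distrib] at hneg
  linarith

theorem hadamardMatrix_transpose (n : ℕ) : (hadamardMatrix n).transpose = hadamardMatrix n := by
  ext i j
  rw [Matrix.transpose_apply, hadamardMatrix_apply, hadamardMatrix_apply, hadamardSign_comm]

theorem hadamardMatrix_mul_self {n : ℕ} (hn : ∃ k : ℕ, n = 2 ^ k) :
    hadamardMatrix n * hadamardMatrix n = 1 := by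
  obtain ⟨k, rfl⟩ := hn
  have hpos : (0 : ℝ) < ((2 ^ k : ℕ) : ℝ) := by positivity
  ext i l
  rw [Matrix.mul_apply]
  simp only [hadamardMatrix_apply, div_mul_div_comm, Real.mul_self_sqrt hpos.le]
  rw [← Finset.sum_div]
  simp only [fun j => hadamardSign_comm (2 ^ k) j (l : ℕ)]
  by_cases hil : i = l
  · subst hil
    simp only [← sq, hadamardSign_sq]
    simp
  · rw [sum_hadamardSign_mul_eq_zero hil, zero_div, Matrix.one_apply_ne hil]

theorem transpose_randomizedHadamard_mul_self {n : ℕ} (hn : ∃ k : ℕ, n = 2 ^ k)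
    (d : Fin n → ℤˣ) : (randomizedHadamard d).transpose * randomizedHadamard d = 1 := by
  rw [randomizedHadamard, Matrix.transpose_mul, hadamardMatrix_transpose,
    Matrix.diagonal_transpose, Matrix.mul_assoc, ← Matrix.mul_assoc (hadamardMatrix n),
    hadamardMatrix_mul_self hn, Matrix.one_mul, Matrix.diagonal_mul_diagonal,
    ← Matrix.diagonal_one]
  congr 1
  ext i
  rcases Int.units_eq_one_or (d i) with h | h <;> simp [h]

/-! ### Kronecker products -/

section Kronecker

variable {P : ℕ} {I : Fin P → ℕ}

theorem sum_prod_kronIndex (f : (p : Fin P) → Fin (I p) → ℝ) :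
    ∑ i : KronIndex I, ∏ p, f p (i p) = ∏ p, ∑ j, f p j := by
  rw [Finset.prod_univ_sum, Fintype.piFinset_univ]

theorem transpose_kronMatrix_mul_self {A : (p : Fin P) → Matrix (Fin (I p)) (Fin (I p)) ℝ}
    (hA : ∀ p, (A p).transpose * A p = 1) : (kronMatrix A).transpose * kronMatrix A = 1 := by
  ext i j
  have hentry : ((kronMatrix A).transpose * kronMatrix A) i j
      = ∏ p, ((A p).transpose * A p) (i p) (j p) := by
    simp only [Matrix.mul_apply, Matrix.transpose_apply, kronMatrix, Matrix.of_apply,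
      ← Finset.prod_mul_distrib]
    exact sum_prod_kronIndex fun p l => A p l (i p) * A p l (j p)
  rw [hentry]
  simp only [hA, Matrix.one_apply]
  rw [Finset.prod_ite_zero]
  simp [funext_iff]

theorem sum_mulVec_sq {ι : Type*} [Fintype ι] [DecidableEq ι] {A : Matrix ι ι ℝ}
    (hA : A.transpose * A = 1) (z : ι → ℝ) : ∑ i, (A.mulVec z i) ^ 2 = ∑ i, z i ^ 2 := by
  have h : A.mulVec z ⬝ᵥ A.mulVec z = z ⬝ᵥ z := by
    rw [Matrix.dotProduct_mulVec, ← Matrix.mulVec_transpose, Matrix.mulVec_mulVec, hA,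
      Matrix.one_mulVec]
  simpa only [dotProduct, ← sq] using h

theorem kronMatrix_mulVec_prod (A : (p : Fin P) → Matrix (Fin (I p)) (Fin (I p)) ℝ)
    (u : (p : Fin P) → Fin (I p) → ℝ) (i : KronIndex I) :
    (kronMatrix A).mulVec (fun j => ∏ p, u p (j p)) i = ∏ p, (A p).mulVec (u p) (i p) := by
  simp only [Matrix.mulVec, dotProduct, kronMatrix, Matrix.of_apply, ← Finset.prod_mul_distrib]
  exact sum_prod_kronIndex fun p j => A p (i p) j * u p j

/-- A linear combination of Kronecker products, where each factor is chosen between two orthogonal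
vectors, satisfies the Pythagorean identity. -/
theorem sum_sq_kron_combination (u : (p : Fin P) → Fin 2 → Fin (I p) → ℝ)
    (hu : ∀ p, ∑ j, u p 0 j * u p 1 j = 0) (c : (Fin P → Fin 2) → ℝ) :
    ∑ i : KronIndex I, (∑ k, c k * ∏ p, u p (k p) (i p)) ^ 2
      = ∑ k, c k ^ 2 * ∏ p, ∑ j, u p (k p) j ^ 2 := by
  have horth : ∀ k l : Fin P → Fin 2, k ≠ l → ∏ p, ∑ j, u p (k p) j * u p (l p) j = 0 := by
    intro k l hkl
    obtain ⟨p, hp⟩ := Function.ne_iff.1 hkl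
    refine Finset.prod_eq_zero (Finset.mem_univ p) ?_
    revert hp
    generalize k p = a
    generalize l p = b
    fin_cases a <;> fin_cases b
    · simp
    · simpa using hu p
    · simpa [mul_comm] using hu p
    · simp
  calc ∑ i : KronIndex I, (∑ k, c k * ∏ p, u p (k p) (i p)) ^ 2
      = ∑ k, ∑ l, c k * c l * ∑ i : KronIndex I, ∏ p, u p (k p) (i p) * u p (l p) (i p) := by
        simp only [sq, Finset.sum_mul_sum]
        simp only [Finset.mul_sum, Finset.prod_mul_distrib]
        rw [Finset.sum_comm]
        refine Finset.sum_congr rfl fun k _ => ?_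
        rw [Finset.sum_comm]
        refine Finset.sum_congr rfl fun l _ => Finset.sum_congr rfl fun i _ => ?_
        ring
    _ = ∑ k, ∑ l, c k * c l * ∏ p, ∑ j, u p (k p) j * u p (l p) j := by
        refine Finset.sum_congr rfl fun k _ => Finset.sum_congr rfl fun l _ => ?_
        rw [sum_prod_kronIndex fun p j => u p (k p) j * u p (l p) j]
    _ = ∑ k, c k ^ 2 * ∏ p, ∑ j, u p (k p) j ^ 2 := by
        refine Finset.sum_congr rfl fun k _ => ?_
        rw [Finset.sum_eq_single k (fun l _ hl => by rw [horth k l hl.symm, mul_zero])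
          (fun h => absurd (Finset.mem_univ k) h)]
        simp only [sq]

/-- Two vectors `a` and `b` are `u 0` and `r • u 0 + u 1` for some orthogonal `u 0`, `u 1`. If
`a = 0`, then `r = 0` by the convention on division by zero, and `u 1 = b`. -/
theorem exists_orthogonal_pair {ι : Type*} [Fintype ι] (a b : ι → ℝ) :
    ∃ (u : Fin 2 → ι → ℝ) (r : ℝ), ∑ j, u 0 j * u 1 j = 0 ∧ (∀ j, a j = u 0 j) ∧
      ∀ j, b j = r * u 0 j + u 1 j := by
  set r := (∑ j, a j * b j) / ∑ j, a j ^ 2 with hr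
  refine ⟨![a, fun j => b j - r * a j], r, ?_, fun j => rfl, fun j => by simp⟩
  have hsum : ∑ j, a j * (b j - r * a j) = ∑ j, a j * b j - r * ∑ j, a j ^ 2 := by
    rw [Finset.mul_sum, ← Finset.sum_sub_distrib]
    exact Finset.sum_congr rfl fun j _ => by ring
  simp only [Matrix.cons_val_zero, Matrix.cons_val_one]
  rw [hsum, hr]
  by_cases h0 : ∑ j, a j ^ 2 = 0
  · have ha : ∀ j, a j = 0 := fun j => pow_eq_zero_iff two_ne_zero |>.1 <|
      (Finset.sum_eq_zero_iff_of_nonneg fun i _ => sq_nonneg (a i)).1 h0 j (Finset.mem_univ j)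
    simp [ha]
  · rw [div_mul_cancel₀ _ h0, sub_self]

/-- The difference of two Kronecker vectors lies in the Kronecker product of planes, which is
spanned by the Kronecker products of orthogonal vectors. -/
theorem exists_orthogonal_combination (x y : (p : Fin P) → Fin (I p) → ℝ) :
    ∃ (u : (p : Fin P) → Fin 2 → Fin (I p) → ℝ) (c : (Fin P → Fin 2) → ℝ),
      (∀ p, ∑ j, u p 0 j * u p 1 j = 0) ∧
      ∀ i : KronIndex I, ∏ p, x p (i p) - ∏ p, y p (i p) = ∑ k, c k * ∏ p, u p (k p) (i p) := by
  choose u r horth hx hy using fun p => exists_orthogonal_pair (x p) (y p)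
  refine ⟨u, fun k => (∏ p, ![1, 0] (k p)) - ∏ p, ![r p, 1] (k p), horth, fun i => ?_⟩
  simp only [sub_mul, Finset.sum_sub_distrib, ← Finset.prod_mul_distrib]
  have hexp : ∀ e : Fin P → Fin 2 → ℝ, ∑ k : Fin P → Fin 2, ∏ p, e p (k p) * u p (k p) (i p)
      = ∏ p, ∑ t, e p t * u p t (i p) := fun e => by
    rw [Finset.prod_univ_sum, Fintype.piFinset_univ]
  rw [hexp fun _ => ![1, 0], hexp fun p => ![r p, 1]]
  simp [Fin.sum_univ_two, hx, hy]

/-- If every squared entry of `A p (u p t)` is at most `τ p` times the squared norm of `u p t`, then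
every squared entry of the image of a combination of the Kronecker products is at most `∏ p, τ p`
times its squared norm, up to the factor `2 ^ P` that the Cauchy–Schwarz inequality costs. -/
theorem sq_kronMatrix_mulVec_combination_le
    (A : (p : Fin P) → Matrix (Fin (I p)) (Fin (I p)) ℝ) (u : (p : Fin P) → Fin 2 → Fin (I p) → ℝ)
    (hu : ∀ p, ∑ j, u p 0 j * u p 1 j = 0) (c : (Fin P → Fin 2) → ℝ) (τ : Fin P → ℝ)
    (hA : ∀ p t i, (A p).mulVec (u p t) i ^ 2 ≤ τ p * ∑ j, u p t j ^ 2) (z : KronIndex I → ℝ)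
    (hz : ∀ i, z i = ∑ k, c k * ∏ p, u p (k p) (i p)) (i : KronIndex I) :
    (kronMatrix A).mulVec z i ^ 2 ≤ 2 ^ P * (∏ p, τ p) * ∑ i, z i ^ 2 := by
  have hlin : (kronMatrix A).mulVec z i
      = ∑ k, c k * ∏ p, (A p).mulVec (u p (k p)) (i p) := by
    have hz' : z = ∑ k, c k • fun i : KronIndex I => ∏ p, u p (k p) (i p) := by
      ext i
      simp [hz]
    rw [hz', Matrix.mulVec_sum, Finset.sum_apply]
    refine Finset.sum_congr rfl fun k _ => ?_
    rw [Matrix.mulVec_smul, Pi.smul_apply, smul_eq_mul,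
      kronMatrix_mulVec_prod A fun p => u p (k p)]
  have hnorm : ∑ i, z i ^ 2 = ∑ k, c k ^ 2 * ∏ p, ∑ j, u p (k p) j ^ 2 := by
    simp only [hz]
    exact sum_sq_kron_combination u hu c
  rw [hlin, hnorm]
  refine sq_sum_le_card_mul_sum_sq.trans ?_
  have hcard : ((Finset.univ : Finset (Fin P → Fin 2)).card : ℝ) = 2 ^ P := by simp
  rw [hcard, mul_assoc, Finset.mul_sum _ _ (∏ p, τ p)]
  gcongr with k
  rw [mul_pow, ← Finset.prod_pow, mul_left_comm, ← Finset.prod_mul_distrib]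
  gcongr with p
  exact hA p (k p) (i p)

end Kronecker

/-! ### Spreading by random signs -/

/-- A randomized Hadamard transform spreads the mass of a vector: each entry of the image exceeds
its typical size by a factor `2 * L` (in square) only with probability `2 * exp (-L)`. -/
theorem measureReal_lt_sq_randomizedHadamard_mulVec_le {n : ℕ} [NeZero n] (w : Fin n → ℝ)
    (i : Fin n) {L : ℝ} (hL : 0 ≤ L) :
    (Measure.pi fun _ : Fin n => (PMF.uniformOfFintype ℤˣ).toMeasure).real
      {d | 2 * L / n * ∑ j, w j ^ 2 < (randomizedHadamard d).mulVec w i ^ 2}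
      ≤ 2 * Real.exp (-L) := by
  have hn : (0 : ℝ) < n := by exact_mod_cast NeZero.pos n
  have hentry : ∀ d : Fin n → ℤˣ, (randomizedHadamard d).mulVec w i
      = ∑ j, hadamardMatrix n i j * w j * (((d j : ℤˣ) : ℤ) : ℝ) := fun d => by
    simp only [Matrix.mulVec, dotProduct, randomizedHadamard, Matrix.mul_diagonal]
    exact Finset.sum_congr rfl fun j _ => by ring
  have hnorm : ∑ j, (hadamardMatrix n i j * w j) ^ 2 = (∑ j, w j ^ 2) / n := by
    rw [Finset.sum_div]
    refine Finset.sum_congr rfl fun j _ => ?_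
    rw [hadamardMatrix_apply, mul_pow, div_pow, hadamardSign_sq, Real.sq_sqrt hn.le]
    ring
  have h := measureReal_lt_sq_rademacher_sum_le (fun j => hadamardMatrix n i j * w j) hL
  simp only [hentry]
  rw [hnorm] at h
  convert h using 5
  ring

/-- A bound on the measure of all sections of a set bounds its product measure. -/
theorem measureReal_prod_le_of_forall {α β : Type*} [MeasurableSpace α] [MeasurableSpace β]
    [DiscreteMeasurableSpace (α × β)] (μ : Measure α) (ν : Measure β) [IsProbabilityMeasure μ]
    [IsProbabilityMeasure ν] (s : Set (α × β)) {c : ℝ} (hc : 0 ≤ c)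
    (h : ∀ a, ν.real (Prod.mk a ⁻¹' s) ≤ c) : (μ.prod ν).real s ≤ c := by
  refine ENNReal.toReal_le_of_le_ofReal hc ?_
  rw [Measure.prod_apply (MeasurableSet.of_discrete)]
  calc ∫⁻ a, ν (Prod.mk a ⁻¹' s) ∂μ ≤ ∫⁻ _, ENNReal.ofReal c ∂μ :=
        lintegral_mono fun a => (ENNReal.le_ofReal_iff_toReal_le (measure_ne_top _ _) hc).2 (h a)
    _ = ENNReal.ofReal c := by simp

/-! ### Sampling and the failure probability for a pair -/

section KFJLT

variable {P : ℕ} {I : Fin P → ℕ} [∀ p, NeZero (I p)] {J : ℕ}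

instance : IsProbabilityMeasure (kfjltLaw I J) := by
  unfold kfjltLaw
  infer_instance

theorem uniformIndex_apply_toReal (i : KronIndex I) :
    (uniformIndex I i).toReal = (∏ p, (I p : ℝ))⁻¹ := by
  simp [uniformIndex, Fintype.card_pi]

theorem samplingMatrix_mulVec {ι : Type*} [Fintype ι] [DecidableEq ι] (q : PMF ι) (v : Fin J → ι)
    (w : ι → ℝ) (j : Fin J) :
    (samplingMatrix q v).mulVec w j = 1 / √((J : ℝ) * (q (v j)).toReal) * w (v j) := by
  rw [samplingMatrix, ← Matrix.mulVec_mulVec, Matrix.mulVec_diagonal]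
  simp [Matrix.mulVec, dotProduct]

theorem norm_kfjlt_sq (ω : KFJLTSeed I J) (z : EuclideanSpace ℝ (KronIndex I)) :
    ‖kfjlt I J ω z‖ ^ 2 = (∏ p, (I p : ℝ)) / J
      * ∑ j, (kronMatrix fun p => randomizedHadamard (ω.1 p)).mulVec z.ofLp (ω.2 j) ^ 2 := by
  rw [EuclideanSpace.real_norm_sq_eq, Finset.mul_sum]
  refine Finset.sum_congr rfl fun j _ => ?_
  have hq : 0 ≤ (J : ℝ) * (∏ p, (I p : ℝ))⁻¹ := by positivity
  simp only [kfjlt, kfjltMatrix]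
  rw [← Matrix.mulVec_mulVec, samplingMatrix_mulVec, uniformIndex_apply_toReal, mul_pow, div_pow,
    Real.sq_sqrt hq, one_pow, one_div, mul_inv, inv_inv]
  ring

theorem kfjlt_sub (ω : KFJLTSeed I J) (x y : EuclideanSpace ℝ (KronIndex I)) :
    kfjlt I J ω x - kfjlt I J ω y = kfjlt I J ω (x - y) := by
  simp only [kfjlt, WithLp.ofLp_sub, Matrix.mulVec_sub, WithLp.toLp_sub]

/-- If the signs spread the mass of `z` so that no squared entry exceeds `M / (I₁ ⋯ I_P)` times
the squared norm, then uniform sampling preserves that norm up to a factor `1 ± ε`. -/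
theorem measureReal_sampling_failure_le (hI : ∀ p, ∃ k : ℕ, I p = 2 ^ k) (hJ : 0 < J) {ε : ℝ}
    (hε : 0 < ε) (hε1 : ε < 1) (d : (p : Fin P) → Fin (I p) → ℤˣ)
    (z : EuclideanSpace ℝ (KronIndex I)) {M : ℝ} (hM : 0 < M)
    (hz : ∀ i, (kronMatrix fun p => randomizedHadamard (d p)).mulVec z.ofLp i ^ 2
      ≤ M / (∏ p, (I p : ℝ)) * ‖z‖ ^ 2) :
    (Measure.pi fun _ : Fin J => (uniformIndex I).toMeasure).real
      {v | ¬ ((1 - ε) * ‖z‖ ^ 2 ≤ ‖kfjlt I J (d, v) z‖ ^ 2 ∧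
        ‖kfjlt I J (d, v) z‖ ^ 2 ≤ (1 + ε) * ‖z‖ ^ 2)} ≤ 2 * Real.exp (-(J / M * ε ^ 2 / 4)) := by
  set w := (kronMatrix fun p => randomizedHadamard (d p)).mulVec z.ofLp with hw
  set K := ∏ p, (I p : ℝ) with hK
  have hK0 : 0 < K := Finset.prod_pos fun p _ => by exact_mod_cast NeZero.pos (I p)
  have hJ0 : (0 : ℝ) < J := by exact_mod_cast hJ
  have hsum : ∑ i, w i ^ 2 = ‖z‖ ^ 2 := by
    rw [EuclideanSpace.real_norm_sq_eq]
    exact sum_mulVec_sq (transpose_kronMatrix_mul_self fun p =>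
      transpose_randomizedHadamard_mul_self (hI p) (d p)) _
  rcases (sq_nonneg ‖z‖).eq_or_lt with h0 | hpos
  · have hw0 : ∀ i, w i ^ 2 = 0 := fun i =>
      le_antisymm (by simpa [← h0] using hz i) (sq_nonneg _)
    simp only [norm_kfjlt_sq, ← hw, hw0, ← h0]
    simp
    positivity
  · have hz0 : ‖z‖ ≠ 0 := fun h => by simp [h] at hpos
    have hmean : ∫ i, K / (M * ‖z‖ ^ 2) * w i ^ 2 ∂(uniformIndex I).toMeasure = 1 / M := by
      rw [PMF.integral_eq_sum]
      simp only [uniformIndex_apply_toReal, ← hK, smul_eq_mul, ← Finset.mul_sum, hsum]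
      field_simp
    have h := measureReal_lt_abs_sum_sub_le (uniformIndex I).toMeasure
      (fun i => K / (M * ‖z‖ ^ 2) * w i ^ 2) (fun i => by positivity)
      (fun i => by
        refine (mul_le_mul_of_nonneg_left (hz i) (by positivity)).trans (le_of_eq ?_)
        field_simp) J hε hε1
    rw [hmean] at h
    rw [show (J : ℝ) / M = J * (1 / M) by ring]
    refine (measureReal_mono fun v hv => ?_).trans h
    rw [Set.mem_ofPred_eq] at hv ⊢
    contrapose! hv
    rw [norm_kfjlt_sq, ← hw, ← hK]
    have hscale : K / J * ∑ j, w (v j) ^ 2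
        = M * ‖z‖ ^ 2 / J * ∑ j, K / (M * ‖z‖ ^ 2) * w (v j) ^ 2 := by
      rw [← Finset.mul_sum]
      field_simp
    set T := ∑ j, K / (M * ‖z‖ ^ 2) * w (v j) ^ 2
    have hc : 0 ≤ M * ‖z‖ ^ 2 / J := by positivity
    have h1 := mul_le_mul_of_nonneg_left (abs_le.1 hv).1 hc
    have h2 := mul_le_mul_of_nonneg_left (abs_le.1 hv).2 hc
    have e1 : M * ‖z‖ ^ 2 / J * (J * (1 / M)) = ‖z‖ ^ 2 := by field_simp
    rw [hscale]
    constructor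
    · linear_combination h1 - (1 - ε) * e1
    · linear_combination h2 + (1 + ε) * e1

/-- The failure probability for a single pair of Kronecker vectors: `κ` for each of the `P` sign
matrices, and `κ` for the sampling. -/
theorem measureReal_pair_failure_le (hI : ∀ p, ∃ k : ℕ, I p = 2 ^ k) {ε κ : ℝ}
    (hε : 0 < ε) (hε1 : ε < 1) (hκ : 0 < κ) (hκ1 : κ ≤ 1)
    (hJ : 4 * (4 ^ P * ∏ p, Real.log (4 * I p / κ)) * (ε ^ 2)⁻¹ * Real.log (2 / κ) ≤ J)
    {x y : EuclideanSpace ℝ (KronIndex I)} (hx : x ∈ kroneckerVectors I)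
    (hy : y ∈ kroneckerVectors I) :
    (kfjltLaw I J).real {ω | ¬ ((1 - ε) * ‖x - y‖ ^ 2 ≤ ‖kfjlt I J ω x - kfjlt I J ω y‖ ^ 2 ∧
      ‖kfjlt I J ω x - kfjlt I J ω y‖ ^ 2 ≤ (1 + ε) * ‖x - y‖ ^ 2)} ≤ (P + 1) * κ := by
  obtain ⟨x', rfl⟩ := hx
  obtain ⟨y', rfl⟩ := hy
  obtain ⟨u, c, hu, hc⟩ := exists_orthogonal_combination (fun p => (x' p).ofLp)
    fun p => (y' p).ofLp
  simp only [kfjlt_sub]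
  set z := kronVec x' - kronVec y' with hz
  have hzc : ∀ i, z.ofLp i = ∑ k, c k * ∏ p, u p (k p) (i p) := hc
  set L : Fin P → ℝ := fun p => Real.log (4 * I p / κ) with hL
  have hI1 : ∀ p, (1 : ℝ) ≤ I p := fun p => by exact_mod_cast NeZero.one_le
  have hL0 : ∀ p, 0 < L p := fun p => Real.log_pos <| by
    rw [lt_div_iff₀ hκ]
    linarith [hI1 p]
  set M : ℝ := 4 ^ P * ∏ p, L p with hM
  have hM0 : 0 < M := mul_pos (by positivity) (Finset.prod_pos fun p _ => hL0 p)
  have hlog : 0 < Real.log (2 / κ) := Real.log_pos <| by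
    rw [lt_div_iff₀ hκ]
    linarith
  have hJ0 : (0 : ℝ) < J := lt_of_lt_of_le (by positivity) hJ
  -- The signs of factor `p` are bad if they fail to spread one of the two vectors of that factor.
  let G : (p : Fin P) → Set (Fin (I p) → ℤˣ) := fun p =>
    ⋃ ti ∈ (Finset.univ : Finset (Fin 2 × Fin (I p))),
      {d | 2 * L p / I p * ∑ j, u p ti.1 j ^ 2 < (randomizedHadamard d).mulVec (u p ti.1) ti.2 ^ 2}
  have hG : ∀ p, (Measure.pi fun _ : Fin (I p) => (PMF.uniformOfFintype ℤˣ).toMeasure).real (G p)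
      ≤ κ := fun p => by
    refine (measureReal_biUnion_finset_le _ _).trans ((Finset.sum_le_sum fun ti _ =>
      measureReal_lt_sq_randomizedHadamard_mulVec_le (u p ti.1) ti.2 (hL0 p).le).trans ?_)
    have := hI1 p
    rw [Real.exp_neg, Real.exp_log (by positivity)]
    simp only [Finset.sum_const, Finset.card_univ, Fintype.card_prod, Fintype.card_fin,
      nsmul_eq_mul]
    push_cast
    refine le_of_eq ?_
    field_simp
    norm_num
  let F : Set (KFJLTSeed I J) := {ω | ¬ ((1 - ε) * ‖z‖ ^ 2 ≤ ‖kfjlt I J ω z‖ ^ 2 ∧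
      ‖kfjlt I J ω z‖ ^ 2 ≤ (1 + ε) * ‖z‖ ^ 2)}
  have hcover : F ⊆ (⋃ p ∈ (Finset.univ : Finset (Fin P)), {ω | ω.1 p ∈ G p})
      ∪ {ω | (∀ p, ω.1 p ∉ G p) ∧ ω ∈ F} := fun ω hω => by
    by_cases h : ∃ p, ω.1 p ∈ G p
    · obtain ⟨p, hp⟩ := h
      exact Or.inl (Set.mem_biUnion (Finset.mem_coe.2 (Finset.mem_univ p)) hp)
    · exact Or.inr ⟨not_exists.1 h, hω⟩
  have hsign : ∀ p, (kfjltLaw I J).real {ω | ω.1 p ∈ G p} ≤ κ := fun p => by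
    have hmp := (measurePreserving_eval (fun p : Fin P => Measure.pi fun _ : Fin (I p) =>
        (PMF.uniformOfFintype ℤˣ).toMeasure) p).comp (measurePreserving_fst
          (ν := Measure.pi fun _ : Fin J => (uniformIndex I).toMeasure))
    refine le_trans (le_of_eq ?_) (hG p)
    exact hmp.measureReal_preimage MeasurableSet.of_discrete.nullMeasurableSet
  have hsample : (kfjltLaw I J).real {ω | (∀ p, ω.1 p ∉ G p) ∧ ω ∈ F} ≤ κ := by
    refine measureReal_prod_le_of_forall _ _ _ hκ.le fun d => ?_
    by_cases hd : ∀ p, d p ∉ G p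
    · refine (measureReal_mono fun v hv => hv.2).trans
        ((measureReal_sampling_failure_le (J := J) hI (by exact_mod_cast hJ0) hε hε1 d z hM0
          fun i => ?_).trans ?_)
      · have h := sq_kronMatrix_mulVec_combination_le (fun p => randomizedHadamard (d p)) u hu c
          (fun p => 2 * L p / I p) (fun p t i => ?_) z.ofLp hzc i
        · rw [EuclideanSpace.real_norm_sq_eq]
          refine h.trans (le_of_eq ?_)
          rw [Finset.prod_div_distrib, Finset.prod_mul_distrib, hM,
            Finset.prod_const, Finset.card_univ, Fintype.card_fin,
            show (4 : ℝ) = 2 * 2 by norm_num, mul_pow]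
          ring
        · by_contra! hlt
          exact hd p (Set.mem_biUnion (Finset.mem_coe.2 (Finset.mem_univ (t, i))) hlt)
      · have hexp : Real.log (2 / κ) ≤ J / M * ε ^ 2 / 4 := by
          have : 4 * M * (ε ^ 2)⁻¹ * Real.log (2 / κ) * (ε ^ 2 / (4 * M)) ≤ J * (ε ^ 2 / (4 * M)) :=
            mul_le_mul_of_nonneg_right hJ (by positivity)
          field_simp at this ⊢
          linarith
        calc 2 * Real.exp (-(J / M * ε ^ 2 / 4)) ≤ 2 * Real.exp (-Real.log (2 / κ)) := by gcongr
          _ = κ := by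
            rw [Real.exp_neg, Real.exp_log (by positivity)]
            field_simp
    · have hempty : Prod.mk d ⁻¹' {ω : KFJLTSeed I J | (∀ p, ω.1 p ∉ G p) ∧ ω ∈ F} = ∅ :=
        Set.eq_empty_of_forall_notMem fun v hv => hd hv.1
      rw [hempty, measureReal_empty]
      exact hκ.le
  calc (kfjltLaw I J).real F ≤ _ := measureReal_mono hcover
    _ ≤ _ := measureReal_union_le _ _
    _ ≤ ∑ _p : Fin P, κ + κ := add_le_add
        ((measureReal_biUnion_finset_le _ _).trans (Finset.sum_le_sum fun p _ => hsign p)) hsample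
    _ = (P + 1) * κ := by
        simp
        ring

end KFJLT

/-! ### The union bound over pairs -/

theorem theorem3 {P : ℕ} (I : Fin P → ℕ) [∀ p, NeZero (I p)] (hI : ∀ p, ∃ k : ℕ, I p = 2 ^ k)
    (J N : ℕ) (ε δ : ℝ) (hε : 0 < ε) (hε1 : ε < 1) (hδ : 0 < δ)
    (hJ : (16 / 3 : ℝ) * 4 ^ P * (ε ^ 2)⁻¹
        * Real.log (4 * (N : ℝ) ^ 2 * ((P : ℝ) + 1) / δ)
        * ∏ p, Real.log (4 * (I p : ℝ) * (N : ℝ) ^ 2 * ((P : ℝ) + 1) / δ) < (J : ℝ)) :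
    IsJLT (kfjltLaw I J) (kfjlt I J) (kroneckerVectors I) ε δ N := by
  intro X hXY hcard
  rcases le_or_gt 1 δ with hδ1 | hδ1
  · exact (sub_nonpos.2 hδ1).trans measureReal_nonneg
  rcases Nat.eq_zero_or_pos N with rfl | hN
  · obtain rfl := Finset.card_eq_zero.1 hcard
    simp [hδ.le]
  have hN1 : (1 : ℝ) ≤ N := by exact_mod_cast hN
  have hNsq : (1 : ℝ) ≤ (N : ℝ) ^ 2 := one_le_pow₀ hN1
  have hP1 : (1 : ℝ) ≤ (P : ℝ) + 1 := by linarith [Nat.cast_nonneg (α := ℝ) P]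
  have hNP : 1 ≤ (N : ℝ) ^ 2 * ((P : ℝ) + 1) := one_le_mul_of_one_le_of_one_le hNsq hP1
  set κ := δ / ((N : ℝ) ^ 2 * ((P : ℝ) + 1)) with hκ
  have hκ0 : 0 < κ := by positivity
  have hκ1 : κ ≤ 1 := (div_le_self hδ.le hNP).trans hδ1.le
  have harg : ∀ a : ℝ, a * (N : ℝ) ^ 2 * ((P : ℝ) + 1) / δ = a / κ := fun a => by
    rw [hκ]
    field_simp
  simp only [harg] at hJ
  have hI1 : ∀ p, (1 : ℝ) ≤ I p := fun p => by exact_mod_cast NeZero.one_le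
  have hprod : 0 ≤ ∏ p, Real.log (4 * I p / κ) := Finset.prod_nonneg fun p _ =>
    Real.log_nonneg <| by
      rw [le_div_iff₀ hκ0]
      linarith [hI1 p]
  have hlog2 : 0 ≤ Real.log (2 / κ) := Real.log_nonneg <| by
    rw [le_div_iff₀ hκ0]
    linarith
  have hlog : Real.log (2 / κ) ≤ Real.log (4 / κ) := by
    gcongr
    norm_num
  have hJ' : 4 * (4 ^ P * ∏ p, Real.log (4 * I p / κ)) * (ε ^ 2)⁻¹ * Real.log (2 / κ) ≤ J := by
    refine le_trans ?_ hJ.le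
    have hE : 0 ≤ 4 ^ P * (ε ^ 2)⁻¹ * ∏ p, Real.log (4 * I p / κ) := by positivity
    have := mul_le_mul_of_nonneg_left (show 4 * Real.log (2 / κ) ≤ 16 / 3 * Real.log (4 / κ) by
      linarith) hE
    linarith
  let F : EuclideanSpace ℝ (KronIndex I) × EuclideanSpace ℝ (KronIndex I) → Set (KFJLTSeed I J) :=
    fun q => {ω | ¬ ((1 - ε) * ‖q.1 - q.2‖ ^ 2 ≤ ‖kfjlt I J ω q.1 - kfjlt I J ω q.2‖ ^ 2 ∧
      ‖kfjlt I J ω q.1 - kfjlt I J ω q.2‖ ^ 2 ≤ (1 + ε) * ‖q.1 - q.2‖ ^ 2)}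
  have hfail : (kfjltLaw I J).real (⋃ q ∈ X ×ˢ X, F q) ≤ δ := by
    refine (measureReal_biUnion_finset_le _ _).trans ((Finset.sum_le_sum fun q hq =>
      measureReal_pair_failure_le hI hε hε1 hκ0 hκ1 hJ'
        (hXY (Finset.mem_product.1 hq).1) (hXY (Finset.mem_product.1 hq).2)).trans (le_of_eq ?_))
    simp only [Finset.sum_const, Finset.card_product, hcard, nsmul_eq_mul]
    push_cast
    rw [hκ]
    field_simp
  rw [sub_le_comm, ← probReal_compl_eq_one_sub (KFJLTSeed.measurableSet _)]
  refine (measureReal_mono (fun ω hω => ?_) (measure_ne_top _ _)).trans hfail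
  rw [Set.mem_compl_iff, Set.mem_ofPred_eq] at hω
  simp only [not_forall] at hω
  obtain ⟨x, hx, y, hy, h⟩ := hω
  rw [Set.mem_iUnion₂]
  exact ⟨(x, y), Finset.mem_product.2 ⟨hx, hy⟩, h⟩
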